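/- Let $\mathbb K$ be a commutative ring. For a $\mathbb K$-module $V$ put $\mathscr F(V)=\bigoplus_{n\ge 0}\mathscr F_n(V)$ with $\mathscr F_n(V)=V^{\otimes n}\otimes\mathbb K\mathfrak S_n$, and write $t\#\sigma$ for $t\otimes\sigma$ ($t\in V^{\otimes n}$, $\sigma\in\mathfrak S_n$). For $\pi\in\mathfrak S_n$ let $\pi(v_1\otimes\cdots\otimes v_n)=v_{\pi^{-1}(1)}\otimes\cdots\otimes v_{\pi^{-1}(n)}$ and $\pi\cdot(t\#\sigma)=\pi(t)\#\pi\sigma$. The external product on $\mathscr F(V)$ is the bilinear associative product, with unit $1\in\mathbb K=\mathscr F_0(V)$, given for $t\in V^{\otimes m}$, $\sigma\in\mathfrak S_m$, $t'\in V^{\otimes n}$, $\sigma'\in\mathfrak S_n$ by $$(t\#\sigma)*(t'\#\sigma')=\sum_{\rho}\rho\cdot\bigl((t\otimes t')\#(\sigma\times\sigma')\bigr),$$ where $\rho$ runs over the permutations of $\{1,\dots,m+n\}$ that are increasing on $\{1,\dots,m\}$ and on $\{m+1,\dots,m+n\}$. If $A$ is a $\mathbb K$-algebra, the internal product on $\mathscr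 F(A)$ is the bilinear product for which $\mathscr F_m(A)\cdot\mathscr F_n(A)=0$ if $m\ne n$, and $(t\#\sigma)\cdot(u\#\tau)=\bigl(t\,\sigma(u)\bigr)\#\sigma\tau$ for $t,u\in A^{\otimes n}$, $\sigma,\tau\in\mathfrak S_n$. If $V$ is a coalgebra with coproduct $\delta$ and counit $\varepsilon$, let $\delta_0=\varepsilon$, $\delta_{n+1}=(\delta_n\otimes\mathrm{id})\circ\delta$ (so that $\delta_1=\mathrm{id}$ and $\delta_2=\delta$) be the iterated coproducts $\delta_n:V\to V^{\otimes n}$, and put $y_{n,v}=\delta_n(v)\#e_n\in\mathscr F_n(V)$ for $n\ge 0$ and $v\in V$, where $e_n$ is the unit of $\mathfrak S_n$. Let $A$ be a cocommutative $\mathbb K$-bialgebra, let $n$ be a positive integer, let $\mathbf c=(c_1,\dots,c_k)$ and $\mathbf d=(d_1,\dots,d_l)$ be two compositions of $n$ (sequences of positive integers with sum $n$), and let $a_1,\dots,a_k,b_1,\dots,b_l\in A$. Let $\mathscr M_{\mathbf c,\mathbf d}$ be the set of $k\times l$ matrices $M=(m_{ij})$ with non-negative integer entries such that $\sum_j m_{ij}=c_i$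 for all $i$ and $\sum_i m_{ij}=d_j$ for all $j$. Then $$(y_{c_1,a_1}*\cdots*y_{c_k,a_k})\cdot(y_{d_1,b_1}*\cdots*y_{d_l,b_l})=\sum_{(a_i),(b_j)}\ \sum_{M\in\mathscr M_{\mathbf c,\mathbf d}}\Bigl(\prod_{j=1}^{l}\prod_{i=1}^{k}y_{m_{ij},\,a_{i(j)}b_{j(i)}}\Bigr),$$ where the first sum is Sweedler notation for the iterated coproducts $\delta_l(a_i)=\sum_{(a_i)}a_{i(1)}\otimes\cdots\otimes a_{i(l)}$ and $\delta_k(b_j)=\sum_{(b_j)}b_{j(1)}\otimes\cdots\otimes b_{j(k)}$ (any decompositions into finite sums of pure tensors may be used), and the products $\prod$ are ordered external products, the entries of $M$ being read column by column: $j=1,\dots,l$ and, within each $j$, $i=1,\dots,k$. -/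

import Mathlib

open scoped TensorProduct DirectSum

noncomputable section

namespace FreeQSym

/-! ### The modules `F_n(V)` and `F(V)` -/

/-- `F_n(V) = V^{⊗ n} # K𝔖_n`. The group algebra `K𝔖_n` is free on `𝔖_n`, so that
`V^{⊗ n} ⊗ K𝔖_n` is the module of formal sums `∑_σ t_σ # σ` with `t_σ ∈ V^{⊗ n}`; the finitely
supported function `σ ↦ t_σ` stands for this formal sum. -/
def Comp (K V : Type*) [CommSemiring K] [AddCommMonoid V] [Module K V] (n : ℕ) : Type _ :=
  Equiv.Perm (Fin n) →₀ ⨂[K]^n V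

section Module

variable {K V : Type*} [CommSemiring K] [AddCommMonoid V] [Module K V]

instance (n : ℕ) : AddCommMonoid (Comp K V n) :=
  inferInstanceAs (AddCommMonoid (Equiv.Perm (Fin n) →₀ ⨂[K]^n V))

instance (n : ℕ) : Module K (Comp K V n) :=
  inferInstanceAs (Module K (Equiv.Perm (Fin n) →₀ ⨂[K]^n V))

/-- The element `t # σ` of `F_n(V)`; it is additive in the tensor `t`. -/
def sharp {n : ℕ} (σ : Equiv.Perm (Fin n)) : ⨂[K]^n V →+ Comp K V n :=
  Finsupp.singleAddHom σ

/-- The coefficient `t_σ` of `∑_σ t_σ # σ`. -/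
def coeff {n : ℕ} (σ : Equiv.Perm (Fin n)) : Comp K V n →+ ⨂[K]^n V :=
  Finsupp.applyAddHom σ

theorem coeff_sharp {n : ℕ} (σ τ : Equiv.Perm (Fin n)) (t : ⨂[K]^n V) :
    coeff τ (sharp σ t) = if σ = τ then t else 0 := by
  classical
  exact (Finsupp.single_apply).trans (by congr)

theorem sum_sharp_coeff {n : ℕ} (α : Comp K V n) : ∑ σ, sharp σ (coeff σ α) = α :=
  Finsupp.univ_sum_single α

/-- The place permutation
`π • (v_1 ⊗ ⋯ ⊗ v_n) = v_{π⁻¹(1)} ⊗ ⋯ ⊗ v_{π⁻¹(n)}` on `V^{⊗ n}`. -/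
def permTensor {n : ℕ} (π : Equiv.Perm (Fin n)) : ⨂[K]^n V ≃ₗ[K] ⨂[K]^n V :=
  PiTensorProduct.reindex K (fun _ => V) π

theorem permTensor_tprod {n : ℕ} (π : Equiv.Perm (Fin n)) (v : Fin n → V) :
    permTensor π (PiTensorProduct.tprod K v) = PiTensorProduct.tprod K fun i => v (π⁻¹ i) :=
  PiTensorProduct.reindex_tprod _ _

/-- The juxtaposition `V^{⊗ m} × V^{⊗ n} → V^{⊗ (m + n)}` of tensors. -/
def concat {m n : ℕ} (t : ⨂[K]^m V) (u : ⨂[K]^n V) : ⨂[K]^(m + n) V :=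
  TensorPower.mulEquiv (t ⊗ₜ[K] u)

theorem concat_tprod {m n : ℕ} (v : Fin m → V) (w : Fin n → V) :
    concat (PiTensorProduct.tprod K v) (PiTensorProduct.tprod K w) =
      PiTensorProduct.tprod K (Fin.append v w) :=
  TensorPower.tprod_mul_tprod K v w

end Module

/-! ### The external product -/

/-- The permutation `σ × σ'` of `{1, …, m + n}`: `σ` acts on the first `m` letters and
`σ'` on the last `n` letters. -/
def permProd {m n : ℕ} (σ : Equiv.Perm (Fin m)) (σ' : Equiv.Perm (Fin n)) :
    Equiv.Perm (Fin (m + n)) :=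
  finSumFinEquiv.permCongr (Equiv.Perm.sumCongr σ σ')

open Classical in
/-- The set `X_{(m,n)}` of the permutations of `{1, …, m + n}` which are increasing on
`{1, …, m}` and on `{m + 1, …, m + n}`. -/
def shuffles (m n : ℕ) : Finset (Equiv.Perm (Fin (m + n))) :=
  Finset.univ.filter fun ρ =>
    StrictMono (fun i : Fin m => ρ (Fin.castAdd n i)) ∧
      StrictMono (fun j : Fin n => ρ (Fin.natAdd m j))

section External

variable {K V : Type*} [CommSemiring K] [AddCommMonoid V] [Module K V]

/-- The external product `F_m(V) × F_n(V) → F_{m+n}(V)`: the biadditive extension of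
`(t # σ) * (u # σ') = x_{(m,n)} · ((t ⊗ u) # (σ × σ'))`, where `x_{(m,n)}` is the sum of
the elements of `X_{(m,n)}` and `ρ · (t # σ) = (ρ • t) # ρσ`. -/
def extProd {m n : ℕ} (α : Comp K V m) (β : Comp K V n) : Comp K V (m + n) :=
  ∑ σ : Equiv.Perm (Fin m), ∑ σ' : Equiv.Perm (Fin n), ∑ ρ ∈ shuffles m n,
    sharp (ρ * permProd σ σ') (permTensor ρ (concat (coeff σ α) (coeff σ' β)))

theorem extProd_sharp {m n : ℕ} (σ : Equiv.Perm (Fin m)) (σ' : Equiv.Perm (Fin n))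
    (t : ⨂[K]^m V) (u : ⨂[K]^n V) :
    extProd (sharp σ t) (sharp σ' u) =
      ∑ ρ ∈ shuffles m n, sharp (ρ * permProd σ σ') (permTensor ρ (concat t u)) := by
  classical
  rw [extProd, Finset.sum_eq_single σ, Finset.sum_eq_single σ']
  · simp [coeff_sharp]
  · intro τ _ h
    simp [coeff_sharp, h.symm, concat]
  · simp
  · intro τ _ h
    simp [coeff_sharp, h.symm, concat]
  · simp

/-- The external product on `F(V) = ⨁ n, F_n(V)` is the multiplication `*` of this direct sum. -/
instance : DirectSum.GNonUnitalNonAssocSemiring (fun n => Comp K V n) where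
  mul := extProd
  mul_zero a := by simp [extProd, concat]
  zero_mul b := by simp [extProd, concat]
  mul_add a b c := by simp [extProd, concat, TensorProduct.tmul_add, Finset.sum_add_distrib]
  add_mul a b c := by simp [extProd, concat, TensorProduct.add_tmul, Finset.sum_add_distrib]

/-- The unit of `F(V)` is the unit of `F_0(V) = K`. -/
instance : GradedMonoid.GOne (fun n => Comp K V n) where
  one := sharp 1 (PiTensorProduct.tprod K Fin.elim0)

end External

end FreeQSym

/-- The free quasisymmetric module `F(V) = ⨁ n, F_n(V)`. Its multiplication `*` is the external
product and its `1` is the unit of the external product. -/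
abbrev FreeQSym (K V : Type*) [CommSemiring K] [AddCommMonoid V] [Module K V] : Type _ :=
  ⨁ n : ℕ, FreeQSym.Comp K V n

namespace FreeQSym

theorem of_mul_of {K V : Type*} [CommSemiring K] [AddCommMonoid V] [Module K V] {m n : ℕ}
    (α : Comp K V m) (β : Comp K V n) :
    (DirectSum.of (fun n => Comp K V n) m α * DirectSum.of (fun n => Comp K V n) n β :
      FreeQSym K V) = DirectSum.of (fun n => Comp K V n) (m + n) (extProd α β) :=
  DirectSum.of_mul_of α β

theorem one_eq {K V : Type*} [CommSemiring K] [AddCommMonoid V] [Module K V] :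
    (1 : FreeQSym K V) =
      DirectSum.of (fun n => Comp K V n) 0 (sharp 1 (PiTensorProduct.tprod K Fin.elim0)) :=
  rfl

/-! ### The internal product -/

section Internal

variable {K A : Type*} [CommSemiring K] [Semiring A] [Algebra K A]

/-- The product of the twisted group ring `F_n(A) = A^{⊗ n} # K𝔖_n`: the biadditive extension of
`(t # σ) · (u # τ) = (t (σ • u)) # στ`. -/
def twistedProd {n : ℕ} (α β : Comp K A n) : Comp K A n :=
  ∑ σ : Equiv.Perm (Fin n), ∑ τ : Equiv.Perm (Fin n),
    sharp (σ * τ) (coeff σ α * permTensor σ (coeff τ β))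

theorem twistedProd_sharp_tprod {n : ℕ} (σ τ : Equiv.Perm (Fin n)) (a b : Fin n → A) :
    twistedProd (sharp σ (PiTensorProduct.tprod K a)) (sharp τ (PiTensorProduct.tprod K b)) =
      sharp (σ * τ) (PiTensorProduct.tprod K fun i => a i * b (σ⁻¹ i)) := by
  classical
  rw [twistedProd, Finset.sum_eq_single σ, Finset.sum_eq_single τ]
  · simp only [coeff_sharp, if_true, permTensor_tprod, PiTensorProduct.tprod_mul_tprod]
    rfl
  · intro τ _ h
    simp [coeff_sharp, h.symm]
  · simp
  · intro τ _ h
    simp [coeff_sharp, h.symm]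
  · simp

/-- The internal product on `F(A)`: `(∑ α_n) · (∑ β_n) = ∑ α_n · β_n`. -/
def internalProd (α β : FreeQSym K A) : FreeQSym K A :=
  DFinsupp.zipWith (fun _ x y => twistedProd x y) (fun _ => by simp [twistedProd]) α β

theorem internalProd_apply (α β : FreeQSym K A) (n : ℕ) :
    internalProd α β n = twistedProd (α n) (β n) :=
  DFinsupp.zipWith_apply _ _ _ _ _

end Internal

/-! ### Iterated coproducts and the elements `y_{n,v}` -/

section Coalgebra

variable (K : Type*) {V : Type*} [CommSemiring K] [AddCommMonoid V] [Module K V] [Coalgebra K V]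

/-- The iterated coproduct `δ_n : V → V^{⊗ n}` of a coalgebra: `δ_0` is the counit and
`δ_{n+1} = (δ_n ⊗ id) ∘ δ`; in particular `δ_1 = id`, `δ_2 = δ`, `δ_3 = (δ ⊗ id) ∘ δ`. -/
def iterComul : (n : ℕ) → V →ₗ[K] ⨂[K]^n V
  | 0 => TensorPower.algebraMap₀.toLinearMap ∘ₗ Coalgebra.counit
  | n + 1 => TensorPower.mulEquiv.toLinearMap ∘ₗ
      TensorProduct.map (iterComul n) (PiTensorProduct.subsingletonEquiv (0 : Fin 1)).symm.toLinearMap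
      ∘ₗ Coalgebra.comul

theorem iterComul_one (v : V) : iterComul K 1 v = PiTensorProduct.tprod K fun _ => v := by
  have r := Coalgebra.Repr.arbitrary K v
  have key : ∀ x w : V, TensorPower.mulEquiv
      ((TensorPower.algebraMap₀ (Coalgebra.counit (R := K) x) : ⨂[K]^0 V) ⊗ₜ[K]
        (PiTensorProduct.tprod K fun _ : Fin 1 => w)) =
      (PiTensorProduct.subsingletonEquiv (R := K) (s := fun _ => V) (0 : Fin 1)).symm
        (Coalgebra.counit (R := K) x • w) := by
    intro x w
    have h : concat (PiTensorProduct.tprod K (Fin.elim0 : Fin 0 → V)) (PiTensorProduct.tprod K fun _ : Fin 1 => w)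
        = PiTensorProduct.tprod K fun _ : Fin (0 + 1) => w := by
      refine (concat_tprod (K := K) (Fin.elim0 : Fin 0 → V) (fun _ : Fin 1 => w)).trans ?_
      congr 1
      funext i
      rw [show i = Fin.natAdd 0 (0 : Fin 1) from Fin.ext (by have := i.isLt; simp)]
      exact Fin.append_right (Fin.elim0 : Fin 0 → V) (fun _ : Fin 1 => w) 0
    rw [TensorPower.algebraMap₀_eq_smul_one, map_smul,
      PiTensorProduct.subsingletonEquiv_symm_apply']
    refine Eq.trans ?_ (congrArg (fun t => Coalgebra.counit (R := K) x • t) h)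
    exact map_smul TensorPower.mulEquiv (Coalgebra.counit (R := K) x)
      ((PiTensorProduct.tprod K (Fin.elim0 : Fin 0 → V)) ⊗ₜ[K]
        (PiTensorProduct.tprod K fun _ : Fin 1 => w))
  simp only [iterComul, LinearMap.comp_apply, ← r.eq, map_sum, TensorProduct.map_tmul,
    LinearEquiv.coe_coe, PiTensorProduct.subsingletonEquiv_symm_apply']
  simp only [key]
  rw [← map_sum, Coalgebra.sum_counit_smul r, PiTensorProduct.subsingletonEquiv_symm_apply']

theorem iterComul_two {ι : Type*} (v : V) (r : Finset ι) (x w : ι → V)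
    (h : Coalgebra.comul (R := K) v = ∑ i ∈ r, x i ⊗ₜ[K] w i) :
    iterComul K 2 v = ∑ i ∈ r, PiTensorProduct.tprod K ![x i, w i] := by
  rw [iterComul]
  simp only [LinearMap.comp_apply, h, map_sum, TensorProduct.map_tmul,
    LinearEquiv.coe_coe, PiTensorProduct.subsingletonEquiv_symm_apply', iterComul_one]
  refine Finset.sum_congr rfl fun i _ => ?_
  refine (concat_tprod (K := K) (fun _ : Fin 1 => x i) (fun _ : Fin 1 => w i)).trans ?_
  congr 1
  funext j
  fin_cases j <;> rfl

/-- A Sweedler decomposition `δ_n(v) = ∑_s v_{(1)}(s) ⊗ ⋯ ⊗ v_{(n)}(s)` of an iterated coproduct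
into a finite sum of pure tensors. It exists for every `n ≥ 1`, see `Sweedler.exists`. -/
structure Sweedler (n : ℕ) (v : V) where
  /-- the number of terms -/
  size : ℕ
  /-- `term s j` is the `j`-th factor `v_{(j)}(s)` of the `s`-th term -/
  term : Fin size → Fin n → V
  eq : iterComul K n v = ∑ s, PiTensorProduct.tprod K (term s)

theorem Sweedler.exists {n : ℕ} (hn : 0 < n) (v : V) : Nonempty (Sweedler K n v) := by
  obtain ⟨l, hl⟩ : ∃ l : List (Fin n → V),
      iterComul K n v = (l.map fun f => PiTensorProduct.tprod K f).sum := by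
    generalize iterComul K n v = t
    induction t using PiTensorProduct.induction_on with
    | smul_tprod r f =>
      refine ⟨[Function.update f ⟨0, hn⟩ (r • f ⟨0, hn⟩)], ?_⟩
      simp [MultilinearMap.map_update_smul]
    | add x y hx hy =>
      obtain ⟨l, rfl⟩ := hx
      obtain ⟨m, rfl⟩ := hy
      exact ⟨l ++ m, by simp⟩
  refine ⟨⟨l.length, fun s => l[s], ?_⟩⟩
  rw [hl]
  exact (Fin.sum_univ_fun_getElem l fun f => PiTensorProduct.tprod K f).symm

/-- The element `y_{n,v} = δ_n(v) # e_n` of `F(V)`; in particular `y_{0,v} = ε(v)`. -/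
def y (n : ℕ) (v : V) : FreeQSym K V :=
  DirectSum.of (fun n => Comp K V n) n (sharp 1 (iterComul K n v))

end Coalgebra

/-! ### Matrices with prescribed margins -/

/-- The set `M_{c,d}` of the matrices with non-negative integral entries, with row sums `c` and
column sums `d`. -/
def marginMatrices {k l : ℕ} (c : Fin k → ℕ) (d : Fin l → ℕ) : Finset (Matrix (Fin k) (Fin l) ℕ) :=
  (Fintype.piFinset fun i => Finset.piAntidiag Finset.univ (c i)).filter
    fun M => ∀ j, ∑ i, M i j = d j

theorem mem_marginMatrices {k l : ℕ} (c : Fin k → ℕ) (d : Fin l → ℕ)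
    (M : Matrix (Fin k) (Fin l) ℕ) :
    M ∈ marginMatrices c d ↔ (∀ i, ∑ j, M i j = c i) ∧ ∀ j, ∑ i, M i j = d j := by
  refine Finset.mem_filter.trans (and_congr_left' ?_)
  exact Fintype.mem_piFinset.trans (by simp [Finset.mem_piAntidiag])

end FreeQSym

end

/-! Both sides are sums over words. Call $f:\{1,\dots,n\}\to\{1,\dots,k\}$ a word of content
$\mathbf c$ if each letter $i$ occurs $c_i$ times. Expanding the shuffles gives
$y_{c_1,a_1}*\cdots*y_{c_k,a_k}=\sum_f t_f\#\sigma_f$, where $t_f$ carries the iterated coproduct of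
$a_i$ at the positions of the letter $i$ and $\sigma_f$ is the stable sorting permutation of $f$
(`extProd_wordComp`, `prod_ofFn_y_univ`).

In the internal product, replacing $g$ by $g\circ\sigma_f^{-1}$ turns $\sigma_f(t_g)$ into the
tensor of the new word. Then $\sigma_f$ times the sort of the old word is the sort of the word of
pairs $(g,f)$ in lexicographic order (`sort_mul_sort`, `twistedProd_wordComp`).

The tensors multiply compatibly: splitting the positions of $i$ in $f$ by the values of $g$ splits
the coproduct of $a_i$ into the $a_{i(j)}$, symmetrically for $b_j$, and since the coproduct is
multiplicative the positions of the pair $(j,i)$ carry the coproduct of $a_{i(j)}b_{j(i)}$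
(`wordTensor_mul`). Finally, words of pairs are grouped by their matrix of multiplicities
(`sum_marginMatrices_words`); each group is again an ordered external product, and lexicographic
order on the pairs is reading the matrix by columns.

Cocommutativity makes the coproduct placed at a set of positions (`spread`) independent of how the
positions are ordered: it is a product of commuting elements of a convolution algebra. -/

noncomputable section

namespace FreeQSym

/-! ### Ordered products over families of separated sets -/

/-- If `F` is multiplicative on `r`-separated finite sets, then the ordered product of its values
on a family of successively `r`-separated sets is its value on the union. -/
theorem prod_ofFn_eq_biUnion {α M : Type*} [DecidableEq α] [Mul M] [One M] (r : α → α → Prop)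
    (F : Finset α → M) (one : F ∅ = 1)
    (mul : ∀ s t, (∀ x ∈ s, ∀ y ∈ t, r x y) → F s * F t = F (s ∪ t)) {n : ℕ}
    (B : Fin n → Finset α) (hB : ∀ i j, i < j → ∀ x ∈ B i, ∀ y ∈ B j, r x y) :
    (List.ofFn fun i => F (B i)).prod = F (Finset.univ.biUnion B) := by
  induction n with
  | zero => simp [one]
  | succ n ih =>
    -- The list product is nested to the right and ends in `1 = F ∅`, so neither associativity nor a
    -- unit law is needed.
    rw [List.ofFn_succ, List.prod_cons, ih (fun i => B i.succ)
      (fun i j hij => hB _ _ (Fin.succ_lt_succ_iff.2 hij)), mul]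
    · congr 1
      ext x
      simp [Fin.exists_fin_succ]
    · intro x hx y hy
      obtain ⟨i, -, hi⟩ := Finset.mem_biUnion.1 hy
      exact hB 0 i.succ (Fin.succ_pos i) x hx y hi

theorem noncommProd_union {α M : Type*} [DecidableEq α] [Monoid M] (f : α → M)
    (comm : Pairwise fun i j => Commute (f i) (f j)) {s t : Finset α} (h : Disjoint s t) :
    (s ∪ t).noncommProd f (comm.set_pairwise _) =
      s.noncommProd f (comm.set_pairwise _) * t.noncommProd f (comm.set_pairwise _) :=
  Finset.noncommProd_union_of_disjoint h f _

theorem prod_ofFn_noncommProd {α M : Type*} [DecidableEq α] [Monoid M] (f : α → M)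
    (comm : Pairwise fun i j => Commute (f i) (f j)) {n : ℕ} (B : Fin n → Finset α)
    (hB : ∀ i j, i < j → Disjoint (B i) (B j)) :
    (List.ofFn fun i => (B i).noncommProd f (comm.set_pairwise _)).prod =
      (Finset.univ.biUnion B).noncommProd f (comm.set_pairwise _) :=
  prod_ofFn_eq_biUnion (· ≠ ·) (fun s => s.noncommProd f (comm.set_pairwise _))
    (Finset.noncommProd_empty _ _)
    (fun _ _ h => (noncommProd_union f comm (Finset.disjoint_iff_ne.2 h)).symm) B
    fun i j hij => Finset.disjoint_iff_ne.1 (hB i j hij)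

theorem prod_ofFn_eq_noncommProd {M : Type*} [Monoid M] {n : ℕ} (f : Fin n → M)
    (comm : Pairwise fun i j => Commute (f i) (f j)) :
    (List.ofFn f).prod = Finset.univ.noncommProd f (comm.set_pairwise _) := by
  have h := prod_ofFn_noncommProd f comm (fun i => {i})
    (fun i j hij => Finset.disjoint_singleton.2 hij.ne)
  simp only [Finset.noncommProd_singleton] at h
  rw [h]
  exact Finset.noncommProd_congr (by ext; simp) (fun _ _ => rfl) _

/-- Expansion of an ordered product of sums. -/
theorem prod_ofFn_sum {K R : Type*} [CommSemiring K] [Semiring R] [Algebra K R] {n : ℕ}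
    {m : Fin n → ℕ} (x : ∀ i, Fin (m i) → R) :
    (List.ofFn fun i => ∑ s, x i s).prod =
      ∑ s : (∀ i, Fin (m i)), (List.ofFn fun i => x i (s i)).prod := by
  have := (MultilinearMap.mkPiAlgebraFin K n R).map_sum x
  simpa only [MultilinearMap.mkPiAlgebraFin_apply] using this

/-! ### The algebra `A^{⊗ n}` -/

section Tensor

variable {K A : Type*} [CommSemiring K] [Semiring A] [Algebra K A]

theorem permTensor_mul {n : ℕ} (π : Equiv.Perm (Fin n)) (t u : ⨂[K]^n A) :
    permTensor π (t * u) = permTensor π t * permTensor π u := by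
  induction t using PiTensorProduct.induction_on with
  | add x y hx hy => simp only [add_mul, map_add, hx, hy]
  | smul_tprod r f =>
    induction u using PiTensorProduct.induction_on with
    | add x y hx hy => simp only [mul_add, map_add, hx, hy]
    | smul_tprod r' f' =>
      simp only [smul_mul_assoc, mul_smul_comm, map_smul, PiTensorProduct.tprod_mul_tprod,
        permTensor_tprod]
      rfl

/-- The element `1 ⊗ ⋯ ⊗ a ⊗ ⋯ ⊗ 1` of `A^{⊗ n}`, with `a` at the place `p`. -/
def place {n : ℕ} (p : Fin n) : A →ₐ[K] ⨂[K]^n A :=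
  PiTensorProduct.singleAlgHom (A := fun _ => A) p

theorem place_apply {n : ℕ} (p : Fin n) (a : A) :
    place (K := K) p a = PiTensorProduct.tprod K (Pi.mulSingle p a : Fin n → A) := rfl

/-- The place permutations as algebra endomorphisms of `A^{⊗ n}`. -/
def permAlgHom {n : ℕ} (π : Equiv.Perm (Fin n)) : ⨂[K]^n A →ₐ[K] ⨂[K]^n A :=
  AlgHom.ofLinearMap (permTensor π).toLinearMap
    (by exact permTensor_tprod (K := K) π (1 : Fin n → A)) (permTensor_mul π)

theorem permAlgHom_apply {n : ℕ} (π : Equiv.Perm (Fin n)) (t : ⨂[K]^n A) :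
    permAlgHom π t = permTensor π t := rfl

/-- The bilinear form of `concat`. -/
def concatLin (m n : ℕ) : ⨂[K]^m A →ₗ[K] ⨂[K]^n A →ₗ[K] ⨂[K]^(m + n) A :=
  (TensorProduct.mk K _ _).compr₂ TensorPower.mulEquiv.toLinearMap

theorem concatLin_apply {m n : ℕ} (t : ⨂[K]^m A) (u : ⨂[K]^n A) :
    concatLin m n t u = concat t u := rfl

theorem concat_mul_concat {m n : ℕ} (t t' : ⨂[K]^m A) (u u' : ⨂[K]^n A) :
    concat t u * concat t' u' = concat (t * t') (u * u') := by
  simp only [← concatLin_apply]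
  induction t using PiTensorProduct.induction_on with
  | add x y hx hy => simp only [add_mul, map_add, LinearMap.add_apply, hx, hy]
  | smul_tprod r f =>
  induction u using PiTensorProduct.induction_on with
  | add x y hx hy => simp only [add_mul, map_add, hx, hy]
  | smul_tprod r f₂ =>
  induction t' using PiTensorProduct.induction_on with
  | add x y hx hy => simp only [mul_add, map_add, LinearMap.add_apply, hx, hy]
  | smul_tprod r f₃ =>
  induction u' using PiTensorProduct.induction_on with
  | add x y hx hy => simp only [mul_add, map_add, hx, hy]
  | smul_tprod r f₄ =>
    have e : Fin.append f f₂ * Fin.append f₃ f₄ = Fin.append (f * f₃) (f₂ * f₄) := by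
      funext i
      induction i using Fin.addCases <;> simp
    simp only [smul_mul_assoc, mul_smul_comm, map_smul, LinearMap.smul_apply,
      PiTensorProduct.tprod_mul_tprod, concatLin_apply, concat_tprod, e, smul_smul]
    congr 1
    ring

theorem concat_one_one {m n : ℕ} : concat (1 : ⨂[K]^m A) (1 : ⨂[K]^n A) = 1 := by
  rw [PiTensorProduct.one_def, PiTensorProduct.one_def, concat_tprod, PiTensorProduct.one_def]
  congr 1
  funext i
  induction i using Fin.addCases <;> simp

/-- The inclusion `t ↦ t ⊗ 1` of `A^{⊗ m}` into `A^{⊗ (m + n)}`. -/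
def concatLeft (m n : ℕ) : ⨂[K]^m A →ₐ[K] ⨂[K]^(m + n) A :=
  AlgHom.ofLinearMap ((concatLin m n).flip 1) concat_one_one fun x y => by
    simp only [LinearMap.flip_apply, concatLin_apply, concat_mul_concat, mul_one]

/-- The inclusion `t ↦ 1 ⊗ t` of `A^{⊗ n}` into `A^{⊗ (m + n)}`. -/
def concatRight (m n : ℕ) : ⨂[K]^n A →ₐ[K] ⨂[K]^(m + n) A :=
  AlgHom.ofLinearMap (concatLin m n 1) concat_one_one fun x y => by
    simp only [concatLin_apply, concat_mul_concat, mul_one]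

/-- Juxtaposition thus becomes a product of two algebra maps, through which commuting products can
be transported. -/
theorem concatLeft_mul_concatRight {m n : ℕ} (t : ⨂[K]^m A) (u : ⨂[K]^n A) :
    concatLeft m n t * concatRight m n u = concat t u := by
  refine (concat_mul_concat t 1 1 u).trans ?_
  rw [mul_one, one_mul]

theorem permAlgHom_single {n : ℕ} (π : Equiv.Perm (Fin n)) (p : Fin n) (a : A) :
    permAlgHom π (place (K := K) p a) =
      place (K := K) (π p) a := by
  rw [place_apply, permAlgHom_apply, permTensor_tprod,
    place_apply]
  congr 1
  funext i
  simp only [Pi.mulSingle_apply, Equiv.Perm.inv_eq_iff_eq]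

theorem concatLeft_single {m n : ℕ} (p : Fin m) (a : A) :
    concatLeft m n (place (K := K) p a) =
      place (K := K) (Fin.castAdd n p) a := by
  rw [place_apply]
  refine (concat_tprod _ _).trans ?_
  rw [place_apply]
  congr 1
  funext i
  induction i using Fin.addCases with
  | left i => simp [Pi.mulSingle_apply]
  | right i => simp [Pi.mulSingle_apply, Fin.ext_iff]; omega

theorem concatRight_single {m n : ℕ} (p : Fin n) (a : A) :
    concatRight m n (place (K := K) p a) =
      place (K := K) (Fin.natAdd m p) a := by
  rw [place_apply]
  refine (concat_tprod _ _).trans ?_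
  rw [place_apply]
  congr 1
  funext i
  induction i using Fin.addCases with
  | left i => simp [Pi.mulSingle_apply, Fin.ext_iff]; omega
  | right i => simp [Pi.mulSingle_apply]

theorem commute_single {n : ℕ} {p q : Fin n} (h : p ≠ q) (a b : A) :
    Commute (place (K := K) p a) (place (K := K) q b) := by
  rw [place_apply, place_apply]
  have h' : Commute (Pi.mulSingle p a : Fin n → A) (Pi.mulSingle q b) :=
    Pi.mulSingle_commute (f := fun _ : Fin n => A) h a b
  exact h'.tprod

theorem prod_ofFn_single {n : ℕ} (v : Fin n → A) :
    (List.ofFn fun p => place (K := K) p (v p)).prod =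
      PiTensorProduct.tprod K v := by
  have h := map_list_prod (PiTensorProduct.tprodMonoidHom (A := fun _ : Fin n => A) K)
    (List.ofFn fun p => (Pi.mulSingle p (v p) : Fin n → A))
  rw [prod_ofFn_eq_noncommProd _ fun p q h => Pi.mulSingle_commute h _ _,
    Finset.noncommProd_mulSingle, List.map_ofFn] at h
  exact h.symm

end Tensor

/-! ### Convolution products and iterated coproducts -/

section Convolution

open WithConv

variable {K A R : Type*} [CommSemiring K] [Semiring A] [Bialgebra K A] [Semiring R] [Algebra K R]

/-- Swapping the two maps amounts to swapping the legs of the coproduct, which cocommutativity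
forgives. This is where cocommutativity does its work. -/
theorem conv_commute [Coalgebra.IsCocomm K A] (f g : WithConv (A →ₗ[K] R))
    (h : ∀ a b, Commute (f a) (g b)) : Commute f g := by
  ext x
  have e : LinearMap.mul' K R ∘ₗ TensorProduct.map f.ofConv g.ofConv =
      LinearMap.mul' K R ∘ₗ TensorProduct.map g.ofConv f.ofConv ∘ₗ
        (TensorProduct.comm K A A).toLinearMap := by
    ext a b
    simpa using (h a b).eq
  have := DFunLike.congr_fun e (Coalgebra.comul (R := K) x)
  simpa [Coalgebra.comm_comul] using this

/-- The linear map `v_1 ⊗ ⋯ ⊗ v_n ↦ φ_1(v_1) ⋯ φ_n(v_n)`. -/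
def prodLift {n : ℕ} (φ : Fin n → WithConv (A →ₗ[K] R)) : ⨂[K]^n A →ₗ[K] R :=
  PiTensorProduct.lift
    ((MultilinearMap.mkPiAlgebraFin K n R).compLinearMap fun i => (φ i).ofConv)

theorem prodLift_tprod {n : ℕ} (φ : Fin n → WithConv (A →ₗ[K] R)) (v : Fin n → A) :
    prodLift φ (PiTensorProduct.tprod K v) = (List.ofFn fun i => φ i (v i)).prod :=
  PiTensorProduct.lift.tprod _

theorem prodLift_concat {m n : ℕ} (φ : Fin (m + n) → WithConv (A →ₗ[K] R))
    (t : ⨂[K]^m A) (v : Fin n → A) :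
    prodLift φ (concat t (PiTensorProduct.tprod K v)) =
      prodLift (fun i => φ (Fin.castAdd n i)) t *
        (List.ofFn fun i => φ (Fin.natAdd m i) (v i)).prod := by
  induction t using PiTensorProduct.induction_on with
  | add x y hx hy =>
    simp only [← concatLin_apply, map_add, LinearMap.add_apply, add_mul] at hx hy ⊢
    rw [hx, hy]
  | smul_tprod r f =>
    simp only [← concatLin_apply, map_smul, LinearMap.smul_apply, smul_mul_assoc]
    rw [concatLin_apply, concat_tprod, prodLift_tprod, prodLift_tprod, ← List.prod_append,
      ← List.ofFn_fin_append]
    congr 3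
    funext i
    induction i using Fin.addCases <;> simp

/-- The convolution product of `φ_1, …, φ_n` is `(φ_1 ⊗ ⋯ ⊗ φ_n) ∘ δ_n`, followed by the
multiplication. -/
theorem convProd_apply {n : ℕ} (φ : Fin n → WithConv (A →ₗ[K] R)) (a : A) :
    (List.ofFn φ).prod a = prodLift φ (iterComul K n a) := by
  induction n generalizing a with
  | zero =>
    have h : iterComul K 0 a =
        Coalgebra.counit (R := K) a • PiTensorProduct.tprod K (Fin.elim0 : Fin 0 → A) := by
      exact TensorPower.algebraMap₀_eq_smul_one _
    rw [h, map_smul, prodLift_tprod]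
    simp [Algebra.algebraMap_eq_smul_one]
  | succ n ih =>
    have r := Coalgebra.Repr.arbitrary K a
    -- The last factor is split off, because `iterComul` adds its new leg on the right.
    rw [List.ofFn_succ', List.concat_eq_append, List.prod_append, List.prod_singleton,
      r.convMul_apply]
    simp only [iterComul, LinearMap.comp_apply, ← r.eq, map_sum, TensorProduct.map_tmul,
      LinearEquiv.coe_coe, PiTensorProduct.subsingletonEquiv_symm_apply']
    refine Finset.sum_congr rfl fun i _ => ?_
    rw [ih]
    refine ((prodLift_concat φ (iterComul K n (r.left i)) fun _ : Fin 1 => r.right i).trans ?_).symm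
    simp
    rfl

end Convolution

/-! ### Iterated coproducts placed at a set of positions -/

section Spread

open WithConv

variable {K A : Type*} [CommSemiring K] [Semiring A] [Bialgebra K A] [Coalgebra.IsCocomm K A]

/-- `place p` as an element of the convolution algebra. -/
def placeConv (K : Type*) {A : Type*} [CommSemiring K] [Semiring A] [Bialgebra K A]
    {n : ℕ} (p : Fin n) : WithConv (A →ₗ[K] ⨂[K]^n A) :=
  toConv (place p).toLinearMap

theorem pairwise_commute_placeConv {n : ℕ} :
    Pairwise fun p q : Fin n => Commute (placeConv K (A := A) p) (placeConv K q) :=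
  fun _ _ h => conv_commute _ _ fun a b => commute_single h a b

/-- The iterated coproduct `δ_{|S|}(a)` placed at the positions `S`, as a function of `a`. -/
def spread (K : Type*) {A : Type*} [CommSemiring K] [Semiring A] [Bialgebra K A]
    [Coalgebra.IsCocomm K A] {n : ℕ} (S : Finset (Fin n)) : WithConv (A →ₗ[K] ⨂[K]^n A) :=
  S.noncommProd (placeConv K) (pairwise_commute_placeConv.set_pairwise _)

theorem spread_empty {n : ℕ} : spread K (A := A) (∅ : Finset (Fin n)) = 1 :=
  Finset.noncommProd_empty _ _

theorem spread_insert {n : ℕ} {p : Fin n} {S : Finset (Fin n)} (h : p ∉ S) :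
    spread K (A := A) (insert p S) = placeConv K p * spread K S :=
  Finset.noncommProd_insert_of_notMem _ _ _ _ h

theorem spread_empty_apply {n : ℕ} (a : A) :
    spread K (∅ : Finset (Fin n)) a = algebraMap K _ (Coalgebra.counit (R := K) a) := by
  rw [spread_empty, LinearMap.convOne_apply]

theorem spread_insert_apply {n : ℕ} {p : Fin n} {S : Finset (Fin n)} (h : p ∉ S) {a : A}
    {ι : Type*} (r : Coalgebra.Repr K a ι) :
    spread K (insert p S) a =
      ∑ i ∈ r.index, place (K := K) p (r.left i) * spread K S (r.right i) := by
  rw [spread_insert h, r.convMul_apply]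
  rfl

theorem commute_place_spread {n : ℕ} {p : Fin n} {S : Finset (Fin n)} (h : p ∉ S) (a b : A) :
    Commute (place (K := K) p a) (spread K S b) := by
  induction S using Finset.induction_on generalizing b with
  | empty =>
    rw [spread_empty_apply]
    exact (Algebra.commutes _ _).symm
  | insert q S hq ih =>
    rw [spread_insert_apply hq (Coalgebra.Repr.arbitrary K b)]
    rw [Finset.mem_insert, not_or] at h
    exact Commute.sum_right _ _ _ fun i _ => (commute_single h.1 _ _).mul_right (ih h.2 _)

theorem commute_spread {n : ℕ} {S T : Finset (Fin n)} (h : Disjoint S T) (a b : A) :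
    Commute (spread K S a) (spread K T b) := by
  induction S using Finset.induction_on generalizing a with
  | empty =>
    rw [spread_empty_apply]
    exact Algebra.commutes _ _
  | insert q S hq ih =>
    rw [spread_insert_apply hq (Coalgebra.Repr.arbitrary K a)]
    rw [Finset.disjoint_insert_left] at h
    exact Commute.sum_left _ _ _ fun i _ => (commute_place_spread h.1 _ _).mul_left (ih h.2 _)

/-- Induction on `S` from multiplicativity of the counit and coproduct: the leg of `b` at a new
place `q` moves past the legs of `a` at the places of `S`, since distinct places commute. -/
theorem spread_mul {n : ℕ} (S : Finset (Fin n)) (a b : A) :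
    spread K S a * spread K S b = spread K S (a * b) := by
  induction S using Finset.induction_on generalizing a b with
  | empty => simp only [spread_empty_apply, Bialgebra.counit_mul, map_mul]
  | insert q S hq ih =>
    have r := Coalgebra.Repr.arbitrary K a
    have r' := Coalgebra.Repr.arbitrary K b
    have h : spread K (insert q S) (a * b) = ∑ i ∈ r.index, ∑ j ∈ r'.index,
        place (K := K) q (r.left i * r'.left j) * spread K S (r.right i * r'.right j) := by
      rw [spread_insert hq, LinearMap.convMul_apply, Bialgebra.comul_mul, ← r.eq, ← r'.eq]
      simp only [Finset.sum_mul_sum, Algebra.TensorProduct.tmul_mul_tmul, map_sum,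
        TensorProduct.map_tmul, LinearMap.mul'_apply]
      rfl
    rw [h, spread_insert_apply hq r, spread_insert_apply hq r', Finset.sum_mul_sum]
    refine Finset.sum_congr rfl fun i _ => Finset.sum_congr rfl fun j _ => ?_
    rw [map_mul, ← ih, mul_assoc, mul_assoc, ← mul_assoc (spread K S _),
      ← (commute_place_spread hq _ _).eq, mul_assoc]

/-- Covers place permutations and both inclusions into a juxtaposition by a single induction on `S`.
-/
theorem map_spread {m n : ℕ} (h : ⨂[K]^m A →ₐ[K] ⨂[K]^n A) (e : Fin m ↪ Fin n)
    (he : ∀ p a, h (place p a) = place (e p) a) (S : Finset (Fin m)) (a : A) :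
    h (spread K S a) = spread K (S.map e) a := by
  induction S using Finset.induction_on generalizing a with
  | empty => rw [Finset.map_empty, spread_empty_apply, spread_empty_apply, AlgHom.commutes]
  | insert q S hq ih =>
    have r := Coalgebra.Repr.arbitrary K a
    rw [Finset.map_insert, spread_insert_apply hq r, spread_insert_apply (by simpa using hq) r,
      map_sum]
    exact Finset.sum_congr rfl fun i _ => by rw [map_mul, he, ih]

theorem spread_biUnion {n l : ℕ} (B : Fin l → Finset (Fin n))
    (hB : ∀ i j, i < j → Disjoint (B i) (B j)) :
    (List.ofFn fun j => spread K (A := A) (B j)).prod = spread K (Finset.univ.biUnion B) :=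
  prod_ofFn_noncommProd _ pairwise_commute_placeConv B hB

/-- The ordered convolution product of all places is the iterated coproduct, because a pure tensor
is the ordered product of its placed factors. -/
theorem spread_univ {n : ℕ} (a : A) : spread K (Finset.univ : Finset (Fin n)) a = iterComul K n a := by
  have h : (List.ofFn (placeConv K (A := A))).prod = spread K (Finset.univ : Finset (Fin n)) :=
    prod_ofFn_eq_noncommProd _ pairwise_commute_placeConv
  rw [← h, convProd_apply]
  have h' : prodLift (placeConv K (A := A)) = LinearMap.id (M := ⨂[K]^n A) := by
    ext v
    exact (prodLift_tprod _ _).trans (prod_ofFn_single v)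
  rw [h', LinearMap.id_apply]

/-- Splitting the positions `S` according to the values of `g` splits the coproduct. -/
theorem spread_eq_sum {n l : ℕ} (S : Finset (Fin n)) (g : Fin n → Fin l) {a : A}
    (p : Sweedler K l a) :
    spread K S a =
      ∑ s, (List.ofFn fun j => spread K (S.filter fun i => g i = j) (p.term s j)).prod := by
  -- `S` is the disjoint union of its parts on which `g` is constant, so its convolution product
  -- factors over them.
  have h : spread K (A := A) S = (List.ofFn fun j => spread K (S.filter fun i => g i = j)).prod := by
    rw [spread_biUnion]
    · congr 1
      ext i
      simp
    · intro i j hij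
      exact Finset.disjoint_filter.2 fun x _ h₁ h₂ => hij.ne (h₁.symm.trans h₂)
  rw [h, convProd_apply, p.eq, map_sum]
  simp only [prodLift_tprod]

end Spread

/-! ### The tensor of a word -/

section Word

variable {K A Λ : Type*} [CommSemiring K] [Semiring A] [Bialgebra K A] [Coalgebra.IsCocomm K A]
  [DecidableEq Λ]

/-- The positions of the letter `x` in the word `f`. -/
def fiber {n : ℕ} (f : Fin n → Λ) (x : Λ) : Finset (Fin n) :=
  Finset.univ.filter fun i => f i = x

theorem mem_fiber {n : ℕ} (f : Fin n → Λ) (x : Λ) (i : Fin n) : i ∈ fiber f x ↔ f i = x := by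
  simp [fiber]

theorem disjoint_fiber {n : ℕ} (f : Fin n → Λ) {x y : Λ} (h : x ≠ y) :
    Disjoint (fiber f x) (fiber f y) :=
  Finset.disjoint_filter.2 fun _ _ h₁ h₂ => h (h₁.symm.trans h₂)

theorem card_fiber_comp {n : ℕ} (f : Fin n → Λ) (σ : Equiv.Perm (Fin n)) (x : Λ) :
    (fiber (fun i => f (σ i)) x).card = (fiber f x).card := by
  have : fiber f x = (fiber (fun i => f (σ i)) x).map σ.toEmbedding := by
    ext i
    simp [mem_fiber, Finset.mem_map_equiv]
  rw [this, Finset.card_map]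

theorem card_fiber_append {m n : ℕ} (f : Fin m → Λ) (g : Fin n → Λ) (x : Λ) :
    (fiber (Fin.append f g) x).card = (fiber f x).card + (fiber g x).card := by
  have : fiber (Fin.append f g) x = ((fiber f x).disjSum (fiber g x)).map
      finSumFinEquiv.toEmbedding := by
    ext i
    rw [Finset.mem_map_equiv]
    induction i using Fin.addCases <;> simp [mem_fiber]
  rw [this, Finset.card_map, Finset.card_disjSum]

theorem commute_fiber {n : ℕ} (f : Fin n → Λ) (a b : Λ → A) :
    Pairwise fun x y => Commute (spread K (fiber f x) (a x)) (spread K (fiber f y) (b y)) :=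
  fun _ _ h => commute_spread (disjoint_fiber f h) _ _

/-- The tensor with the iterated coproduct of `a x` at the positions of the letter `x` in the
word `f`, for all letters `x ∈ B`. -/
def wordTensor (K : Type*) {A Λ : Type*} [CommSemiring K] [Semiring A] [Bialgebra K A]
    [Coalgebra.IsCocomm K A] [DecidableEq Λ] {n : ℕ} (B : Finset Λ) (a : Λ → A) (f : Fin n → Λ) :
    ⨂[K]^n A :=
  B.noncommProd (fun x => spread K (fiber f x) (a x)) ((commute_fiber f a a).set_pairwise _)

theorem permTensor_wordTensor {n : ℕ} (π : Equiv.Perm (Fin n)) (B : Finset Λ) (a : Λ → A)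
    (f : Fin n → Λ) :
    permTensor π (wordTensor K B a f) = wordTensor K B a fun i => f (π⁻¹ i) := by
  rw [← permAlgHom_apply, wordTensor, Finset.map_noncommProd]
  refine Finset.noncommProd_congr rfl (fun x _ => ?_) _
  rw [map_spread _ π.toEmbedding fun p a => permAlgHom_single π p a]
  refine congrArg (fun S => spread K S (a x)) (Finset.ext fun i => ?_)
  simp [mem_fiber, Finset.mem_map_equiv]

theorem concat_wordTensor {m n : ℕ} {B C : Finset Λ} (h : Disjoint B C) (a : Λ → A)
    (f : Fin m → Λ) (g : Fin n → Λ) (hf : ∀ i, f i ∈ B) (hg : ∀ i, g i ∈ C) :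
    concat (wordTensor K B a f) (wordTensor K C a g) =
      wordTensor K (B ∪ C) a (Fin.append f g) := by
  rw [← concatLeft_mul_concatRight, wordTensor, wordTensor, Finset.map_noncommProd,
    Finset.map_noncommProd]
  refine Eq.trans ?_ (noncommProd_union _ (commute_fiber _ a a) h).symm
  congr 1
  · refine Finset.noncommProd_congr rfl (fun x hx => ?_) _
    rw [map_spread _ (Fin.castAddEmb n) fun p a => concatLeft_single p a]
    refine congrArg (fun S => spread K S (a x)) (Finset.ext fun i => ?_)
    induction i using Fin.addCases with
    | left i => simp [mem_fiber]
    | right i =>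
      have : g i ≠ x := fun e => Finset.disjoint_left.1 h hx (e ▸ hg i)
      simp [mem_fiber, this, Fin.ext_iff]
      omega
  · refine Finset.noncommProd_congr rfl (fun x hx => ?_) _
    rw [map_spread _ (Fin.natAddEmb m) fun p a => concatRight_single p a]
    refine congrArg (fun S => spread K S (a x)) (Finset.ext fun i => ?_)
    induction i using Fin.addCases with
    | left i =>
      have : f i ≠ x := fun e => Finset.disjoint_left.1 h (e ▸ hf i) hx
      simp [mem_fiber, this, Fin.ext_iff]
      omega
    | right i => simp [mem_fiber]

theorem wordTensor_eq_prod {n k : ℕ} (a : Fin k → A) (f : Fin n → Fin k) :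
    wordTensor K Finset.univ a f = (List.ofFn fun i => spread K (fiber f i) (a i)).prod :=
  (prod_ofFn_eq_noncommProd _ (commute_fiber f a a)).symm

/-- Together with the primed version: for commuting entries, reading by rows or by columns gives the
same product. The $a_i$ produce one order, the $b_j$ the other. -/
theorem prod_prod_eq_noncommProd {M : Type*} [Monoid M] {k l : ℕ} (x : Fin l ×ₗ Fin k → M)
    (h : Pairwise fun i j => Commute (x i) (x j)) :
    (List.ofFn fun i => (List.ofFn fun j => x (toLex (j, i))).prod).prod =
      Finset.univ.noncommProd x (h.set_pairwise _) := by
  have e : ∀ i, (List.ofFn fun j => x (toLex (j, i))).prod =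
      (Finset.univ.biUnion fun j => {toLex (j, i)}).noncommProd x (h.set_pairwise _) := by
    intro i
    rw [← prod_ofFn_noncommProd x h (fun j => {toLex (j, i)})
      (fun j j' hj => Finset.disjoint_singleton.2 fun e => hj.ne (congrArg (fun z => (ofLex z).1) e))]
    simp only [Finset.noncommProd_singleton]
  simp only [e]
  rw [prod_ofFn_noncommProd x h]
  · refine Finset.noncommProd_congr ?_ (fun _ _ => rfl) _
    ext z
    simp only [Finset.mem_biUnion, Finset.mem_univ, true_and, Finset.mem_singleton, iff_true]
    exact ⟨(ofLex z).2, (ofLex z).1, rfl⟩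
  · intro i i' hi
    simp only [Finset.disjoint_left, Finset.mem_biUnion, Finset.mem_univ, true_and,
      Finset.mem_singleton]
    rintro _ ⟨j, rfl⟩ ⟨j', e⟩
    exact hi.ne (congrArg (fun z => (ofLex z).2) e)

theorem prod_prod_eq_noncommProd' {M : Type*} [Monoid M] {k l : ℕ} (x : Fin l ×ₗ Fin k → M)
    (h : Pairwise fun i j => Commute (x i) (x j)) :
    (List.ofFn fun j => (List.ofFn fun i => x (toLex (j, i))).prod).prod =
      Finset.univ.noncommProd x (h.set_pairwise _) := by
  have e : ∀ j, (List.ofFn fun i => x (toLex (j, i))).prod =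
      (Finset.univ.biUnion fun i => {toLex (j, i)}).noncommProd x (h.set_pairwise _) := by
    intro j
    rw [← prod_ofFn_noncommProd x h (fun i => {toLex (j, i)})
      (fun i i' hi => Finset.disjoint_singleton.2 fun e => hi.ne (congrArg (fun z => (ofLex z).2) e))]
    simp only [Finset.noncommProd_singleton]
  simp only [e]
  rw [prod_ofFn_noncommProd x h]
  · refine Finset.noncommProd_congr ?_ (fun _ _ => rfl) _
    ext z
    simp only [Finset.mem_biUnion, Finset.mem_univ, true_and, Finset.mem_singleton, iff_true]
    exact ⟨(ofLex z).1, (ofLex z).2, rfl⟩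
  · intro j j' hj
    simp only [Finset.disjoint_left, Finset.mem_biUnion, Finset.mem_univ, true_and,
      Finset.mem_singleton]
    rintro _ ⟨i, rfl⟩ ⟨i', e⟩
    exact hj.ne (congrArg (fun z => (ofLex z).1) e)

/-- Positions with $f=i$ and $g=j$ form the fibre of the pair $(j,i)$. It receives one leg of $a_i$
and one of $b_j$, and these merge by `spread_mul`. -/
theorem wordTensor_mul {n k l : ℕ} (a : Fin k → A) (b : Fin l → A)
    (p : ∀ i, Sweedler K l (a i)) (q : ∀ j, Sweedler K k (b j))
    (f : Fin n → Fin k) (g : Fin n → Fin l) :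
    wordTensor K Finset.univ a f * wordTensor K Finset.univ b g =
      ∑ s : (∀ i, Fin (p i).size), ∑ t : (∀ j, Fin (q j).size),
        wordTensor K Finset.univ
          (fun z : Fin l ×ₗ Fin k => (p (ofLex z).2).term (s (ofLex z).2) (ofLex z).1 *
            (q (ofLex z).1).term (t (ofLex z).1) (ofLex z).2)
          fun i => toLex (g i, f i) := by
  have hf : ∀ i j, (fiber f i).filter (fun x => g x = j) =
      fiber (fun x => toLex (g x, f x)) (toLex (j, i)) := by
    intro i j
    ext x
    simp [mem_fiber, and_comm]
  have hg : ∀ i j, (fiber g j).filter (fun x => f x = i) =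
      fiber (fun x => toLex (g x, f x)) (toLex (j, i)) := by
    intro i j
    ext x
    simp [mem_fiber]
  rw [wordTensor_eq_prod, wordTensor_eq_prod]
  simp only [fun i => spread_eq_sum (fiber f i) g (p i), fun j => spread_eq_sum (fiber g j) f (q j),
    hf, hg]
  rw [prod_ofFn_sum (K := K), prod_ofFn_sum (K := K), Finset.sum_mul_sum]
  refine Finset.sum_congr rfl fun s _ => Finset.sum_congr rfl fun t _ => ?_
  set h := fun x => toLex (g x, f x)
  set u : Fin l ×ₗ Fin k → A := fun z => (p (ofLex z).2).term (s (ofLex z).2) (ofLex z).1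
  set v : Fin l ×ₗ Fin k → A := fun z => (q (ofLex z).1).term (t (ofLex z).1) (ofLex z).2
  have hu := prod_prod_eq_noncommProd (fun z => spread K (fiber h z) (u z)) (commute_fiber h u u)
  have hv := prod_prod_eq_noncommProd' (fun z => spread K (fiber h z) (v z)) (commute_fiber h v v)
  refine (congrArg₂ (· * ·) hu hv).trans ?_
  -- Factors of different letters have disjoint fibres and commute, so the two products combine
  -- letter by letter.
  rw [← Finset.noncommProd_mul_distrib _ _ _ _ ((commute_fiber h v u).set_pairwise _)]
  exact Finset.noncommProd_congr rfl (fun z _ => spread_mul _ _ _) _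

end Word

/-! ### Stable sorting -/

section Sorting

variable {α β : Type*} [LinearOrder α] [LinearOrder β]

/-- Sorting by the second key and then stably by the first key is sorting lexicographically. -/
theorem sort_mul_sort {n : ℕ} (f : Fin n → α) (g : Fin n → β) :
    Tuple.sort f * Tuple.sort (fun i => g (Tuple.sort f i)) =
      Tuple.sort fun i => toLex (g i, f i) := by
  obtain ⟨hf, hf'⟩ := Tuple.eq_sort_iff.1 (rfl : Tuple.sort f = Tuple.sort f)
  obtain ⟨hg, hg'⟩ := Tuple.eq_sort_iff.1
    (rfl : Tuple.sort (fun i => g (Tuple.sort f i)) = Tuple.sort (fun i => g (Tuple.sort f i)))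
  set σ := Tuple.sort f
  set τ := Tuple.sort fun i => g (σ i)
  rw [Tuple.eq_sort_iff]
  refine ⟨monotone_iff_forall_lt.2 fun i j hij => ?_, fun i j hij e => ?_⟩
  · refine Prod.Lex.toLex_le_toLex.2 ?_
    -- When the values of `g` tie, stability of `τ` keeps the positions in order, and `σ` has
    -- already sorted `f` along them.
    rcases (hg hij.le).lt_or_eq with h | h
    · exact Or.inl h
    · exact Or.inr ⟨h, hf (hg' i j hij h).le⟩
  · have e' := Prod.ext_iff.1 (toLex.injective e)
    exact hf' _ _ (hg' i j hij e'.1) e'.2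

theorem inv_apply_apply {ι : Type*} (σ : Equiv.Perm ι) (i : ι) : σ⁻¹ (σ i) = i :=
  σ.symm_apply_apply i

theorem permProd_castAdd {m n : ℕ} (σ : Equiv.Perm (Fin m)) (σ' : Equiv.Perm (Fin n))
    (i : Fin m) : permProd σ σ' (Fin.castAdd n i) = Fin.castAdd n (σ i) := by
  simp [permProd, Equiv.permCongr_apply]

theorem permProd_natAdd {m n : ℕ} (σ : Equiv.Perm (Fin m)) (σ' : Equiv.Perm (Fin n))
    (i : Fin n) : permProd σ σ' (Fin.natAdd m i) = Fin.natAdd m (σ' i) := by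
  simp [permProd, Equiv.permCongr_apply]

theorem mem_shuffles {m n : ℕ} (ρ : Equiv.Perm (Fin (m + n))) :
    ρ ∈ shuffles m n ↔ StrictMono (fun i : Fin m => ρ (Fin.castAdd n i)) ∧
      StrictMono (fun j : Fin n => ρ (Fin.natAdd m j)) := by
  simp [shuffles]

/-- Every letter of `f` precedes every letter of `g`, so sorting the shuffled word lists the
`f`-part before the `g`-part. As `ρ` is increasing on each block, it preserves stability. -/
theorem shuffle_mul_sort {m n : ℕ} {ρ : Equiv.Perm (Fin (m + n))} (hρ : ρ ∈ shuffles m n)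
    (f : Fin m → α) (g : Fin n → α) (h : ∀ i j, f i < g j) :
    ρ * permProd (Tuple.sort f) (Tuple.sort g) =
      Tuple.sort fun i => Fin.append f g (ρ⁻¹ i) := by
  obtain ⟨h₁, h₂⟩ := (mem_shuffles ρ).1 hρ
  obtain ⟨hf, hf'⟩ := Tuple.eq_sort_iff.1 (rfl : Tuple.sort f = Tuple.sort f)
  obtain ⟨hg, hg'⟩ := Tuple.eq_sort_iff.1 (rfl : Tuple.sort g = Tuple.sort g)
  rw [Tuple.eq_sort_iff]
  refine ⟨monotone_iff_forall_lt.2 fun i j hij => ?_, fun i j hij e => ?_⟩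
  · simp only [Function.comp_apply, Equiv.Perm.mul_apply, inv_apply_apply]
    induction i using Fin.addCases with
    | left i =>
      induction j using Fin.addCases with
      | left j =>
        simp only [permProd_castAdd, Fin.append_left]
        exact hf (show i ≤ j from hij.le)
      | right j =>
        simp only [permProd_castAdd, permProd_natAdd, Fin.append_left, Fin.append_right]
        exact (h _ _).le
    | right i =>
      induction j using Fin.addCases with
      | left j => simp [Fin.lt_def] at hij; omega
      | right j =>
        simp only [permProd_natAdd, Fin.append_right]
        exact hg (by simpa using hij.le)
  · simp only [Equiv.Perm.mul_apply, inv_apply_apply] at e ⊢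
    induction i using Fin.addCases with
    | left i =>
      induction j using Fin.addCases with
      | left j =>
        simp only [permProd_castAdd, Fin.append_left] at e ⊢
        exact h₁ (hf' i j hij e)
      | right j =>
        simp only [permProd_castAdd, permProd_natAdd, Fin.append_left, Fin.append_right] at e
        exact absurd e (h _ _).ne
    | right i =>
      induction j using Fin.addCases with
      | left j => simp [Fin.lt_def] at hij; omega
      | right j =>
        simp only [permProd_natAdd, Fin.append_right] at e ⊢
        exact h₂ (hg' i j (by simpa using hij) e)

end Sorting

/-! ### Sums over words -/

/-- The external product distributes over finite sums. -/
theorem extProd_sum {ι κ : Type*} {K V : Type*} [CommSemiring K]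
    [AddCommMonoid V] [Module K V] {m n : ℕ}
    (s : Finset ι) (t : Finset κ) (α : ι → Comp K V m)
    (β : κ → Comp K V n) :
    extProd (∑ i ∈ s, α i) (∑ j ∈ t, β j) = ∑ i ∈ s, ∑ j ∈ t, extProd (α i) (β j) := by
  have := map_sum (DirectSum.gMulHom (fun n => Comp K V n) (i := m) (j := n)) α s
  have h := DFunLike.congr_fun this (∑ j ∈ t, β j)
  rw [AddMonoidHom.finsetSum_apply] at h
  refine h.trans (Finset.sum_congr rfl fun i _ => ?_)
  exact map_sum (DirectSum.gMulHom (fun n => Comp K V n) (i := m) (j := n) (α i)) β t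

section Words

variable {Λ : Type*} [LinearOrder Λ] [Fintype Λ]

/-- The words of length `n` with `c x` letters `x` for every `x ∈ B`, and with no other letters. -/
def words (n : ℕ) (B : Finset Λ) (c : Λ → ℕ) : Finset (Fin n → Λ) :=
  Finset.univ.filter fun f => ∀ x, (fiber f x).card = if x ∈ B then c x else 0

theorem mem_words {n : ℕ} {B : Finset Λ} {c : Λ → ℕ} {f : Fin n → Λ} :
    f ∈ words n B c ↔ ∀ x, (fiber f x).card = if x ∈ B then c x else 0 := by
  simp [words]

theorem apply_mem_of_mem_words {n : ℕ} {B : Finset Λ} {c : Λ → ℕ} {f : Fin n → Λ}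
    (hf : f ∈ words n B c) (i : Fin n) : f i ∈ B := by
  by_contra h
  have := mem_words.1 hf (f i)
  rw [if_neg h, Finset.card_eq_zero] at this
  exact Finset.notMem_empty i (this ▸ (mem_fiber f (f i) i).2 rfl)

theorem comp_mem_words {n : ℕ} {B : Finset Λ} {c : Λ → ℕ} {f : Fin n → Λ}
    (σ : Equiv.Perm (Fin n)) : (fun i => f (σ i)) ∈ words n B c ↔ f ∈ words n B c := by
  simp only [mem_words, card_fiber_comp]

theorem append_mem_words {m n : ℕ} {B C : Finset Λ} (h : Disjoint B C) {c : Λ → ℕ}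
    {f : Fin m → Λ} {g : Fin n → Λ} (hf : f ∈ words m B c) (hg : g ∈ words n C c) :
    Fin.append f g ∈ words (m + n) (B ∪ C) c := by
  rw [mem_words] at *
  intro x
  rw [card_fiber_append, hf, hg]
  by_cases hB : x ∈ B
  · simp [hB, Finset.disjoint_left.1 h hB]
  · simp [hB]

theorem mem_words_of_append {m n : ℕ} {B C : Finset Λ} (h : Disjoint B C) {c : Λ → ℕ}
    {f : Fin m → Λ} {g : Fin n → Λ} (hf : ∀ i, f i ∈ B) (hg : ∀ i, g i ∈ C)
    (hfg : Fin.append f g ∈ words (m + n) (B ∪ C) c) :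
    f ∈ words m B c ∧ g ∈ words n C c := by
  have key : ∀ {k : ℕ} {D : Finset Λ} {u : Fin k → Λ}, (∀ i, u i ∈ D) → ∀ x ∉ D,
      (fiber u x).card = 0 := by
    intro k D u hu x hx
    rw [Finset.card_eq_zero, Finset.eq_empty_iff_forall_notMem]
    intro i hi
    exact hx ((mem_fiber _ _ _).1 hi ▸ hu i)
  simp only [mem_words, card_fiber_append] at *
  refine ⟨fun x => ?_, fun x => ?_⟩
  · have := hfg x
    by_cases hB : x ∈ B
    · rw [key hg x (Finset.disjoint_left.1 h hB)] at this
      simpa [hB] using this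
    · rw [key hf x hB, if_neg hB]
  · have := hfg x
    by_cases hC : x ∈ C
    · rw [key hf x (Finset.disjoint_right.1 h hC)] at this
      simpa [hC] using this
    · rw [key hg x hC, if_neg hC]

/-- The number of positions with letters in `B`. -/
theorem card_filter_mem {n : ℕ} {B C : Finset Λ} (h : Disjoint B C) {c : Λ → ℕ} {f : Fin n → Λ}
    (hf : f ∈ words n (B ∪ C) c) :
    (Finset.univ.filter fun i => decide (f i ∈ C) ≤ false).card = ∑ x ∈ B, c x := by
  have : (Finset.univ.filter fun i => decide (f i ∈ C) ≤ false) = B.biUnion (fiber f) := by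
    ext i
    have := Finset.mem_union.1 (apply_mem_of_mem_words hf i)
    simp only [Finset.mem_filter, Finset.mem_univ, true_and, Finset.mem_biUnion, mem_fiber,
      exists_eq_right', Bool.le_iff_imp, decide_eq_true_eq, Bool.false_eq_true, imp_false]
    exact ⟨fun hC => this.resolve_right hC, fun hB hC => Finset.disjoint_left.1 h hB hC⟩
  rw [this, Finset.card_biUnion fun x _ y _ hxy => disjoint_fiber f hxy]
  refine Finset.sum_congr rfl fun x hx => ?_
  rw [mem_words.1 hf, if_pos (Finset.mem_union_left _ hx)]

end Words

/-! ### External products as sums over words -/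

section WordComp

variable {K A Λ : Type*} [CommSemiring K] [Semiring A] [Bialgebra K A] [Coalgebra.IsCocomm K A]
  [LinearOrder Λ] [Fintype Λ]

/-- The sum of `t_f # σ_f` over the words `f` in `words n B c`, where `t_f` is the tensor of the
word `f` and `σ_f` is the permutation which sorts `f`. -/
def wordComp (K : Type*) {A Λ : Type*} [CommSemiring K] [Semiring A] [Bialgebra K A]
    [Coalgebra.IsCocomm K A] [LinearOrder Λ] [Fintype Λ] (n : ℕ) (B : Finset Λ) (c : Λ → ℕ)
    (a : Λ → A) : Comp K A n :=
  ∑ f ∈ words n B c, sharp (Tuple.sort f) (wordTensor K B a f)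

/-- A word on `B ∪ C` is the same as its subword on `B`, its subword on `C` and the shuffle
interleaving them. -/
theorem extProd_wordComp {m n : ℕ} {B C : Finset Λ} (h : ∀ x ∈ B, ∀ y ∈ C, x < y) (c : Λ → ℕ)
    (a : Λ → A) (hm : ∑ x ∈ B, c x = m) :
    extProd (wordComp K m B c a) (wordComp K n C c a) = wordComp K (m + n) (B ∪ C) c a := by
  have hd : Disjoint B C := Finset.disjoint_left.2 fun x hB hC => (h x hB x hC).false
  -- The shuffle is recovered from the word as the stable sort of the indicator of `C`, with `false
  -- < true`; this supplies the inverse map below.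
  have key : ∀ f ∈ words m B c, ∀ g ∈ words n C c, ∀ ρ ∈ shuffles m n,
      Tuple.sort (fun i => decide (Fin.append f g (ρ⁻¹ i) ∈ C)) = ρ := by
    intro f hf g hg ρ hρ
    have hf' : ∀ i, f i ∉ C := fun i hi =>
      Finset.disjoint_left.1 hd (apply_mem_of_mem_words hf i) hi
    have hg' := apply_mem_of_mem_words hg
    obtain ⟨h₁, h₂⟩ := (mem_shuffles ρ).1 hρ
    refine (Tuple.eq_sort_iff.2 ⟨monotone_iff_forall_lt.2 fun i j hij => ?_,
      fun i j hij e => ?_⟩).symm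
    · simp only [Function.comp_apply, inv_apply_apply]
      induction i using Fin.addCases with
      | left i => simp [hf']
      | right i =>
        induction j using Fin.addCases with
        | left j => simp [Fin.lt_def] at hij; omega
        | right j => simp [hg']
    · simp only [inv_apply_apply] at e
      induction i using Fin.addCases with
      | left i =>
        induction j using Fin.addCases with
        | left j => exact h₁ (show i < j from hij)
        | right j => simp [hf', hg'] at e
      | right i =>
        induction j using Fin.addCases with
        | left j => simp [hf', hg'] at e
        | right j => exact h₂ (by simpa using hij)
  rw [wordComp, wordComp, extProd_sum, wordComp, ← Finset.sum_product']
  simp only [extProd_sharp]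
  rw [← Finset.sum_product']
  refine Finset.sum_nbij'
    (fun z i => Fin.append z.1.1 z.1.2 (z.2⁻¹ i))
    (fun w => ((fun i => w (Tuple.sort (fun i => decide (w i ∈ C)) (Fin.castAdd n i)),
      fun i => w (Tuple.sort (fun i => decide (w i ∈ C)) (Fin.natAdd m i))),
      Tuple.sort (fun i => decide (w i ∈ C)))) ?_ ?_ ?_ ?_ ?_
  · rintro ⟨⟨f, g⟩, ρ⟩ hz
    simp only [Finset.mem_product] at hz
    exact (comp_mem_words ρ⁻¹).2 (append_mem_words hd hz.1.1 hz.1.2)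
  · intro w hw
    obtain ⟨hs, hs'⟩ := Tuple.eq_sort_iff.1
      (rfl : Tuple.sort (fun i => decide (w i ∈ C)) = Tuple.sort (fun i => decide (w i ∈ C)))
    set ρ := Tuple.sort (fun i => decide (w i ∈ C))
    have hw' := (comp_mem_words ρ).2 hw
    -- After sorting by the indicator, the letters outside `C` fill an initial segment whose length
    -- is the number of letters from `B`, namely `m`.
    have hlt : ∀ i : Fin (m + n), (i : ℕ) < m ↔ w (ρ i) ∉ C := by
      intro i
      have := Tuple.lt_card_le_iff_apply_le_of_monotone (j := i) (a := false) hs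
      simp only [Function.comp_apply] at this
      rw [card_filter_mem hd hw', hm] at this
      rw [this]
      simp only [Bool.le_iff_imp, decide_eq_true_eq, Bool.false_eq_true, imp_false]
    have hl : ∀ i, w (ρ (Fin.castAdd n i)) ∉ C := fun i => (hlt _).1 (by simp)
    have hr : ∀ i, w (ρ (Fin.natAdd m i)) ∈ C := fun i => by
      by_contra hc
      simpa using (hlt _).2 hc
    have hl' : ∀ i, w (ρ (Fin.castAdd n i)) ∈ B := fun i =>
      (Finset.mem_union.1 (apply_mem_of_mem_words hw _)).resolve_right (hl i)
    rw [Finset.mem_product, Finset.mem_product]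
    refine ⟨mem_words_of_append hd hl' hr ?_, ?_⟩
    · convert hw' using 1
      funext i
      induction i using Fin.addCases <;> simp
    · rw [mem_shuffles]
      exact ⟨fun i j hij => hs' _ _ hij (by simp [hl]),
        fun i j hij => hs' _ _ (by simpa using hij) (by simp [hr])⟩
  · rintro ⟨⟨f, g⟩, ρ⟩ hz
    simp only [Finset.mem_product] at hz
    simp only [key f hz.1.1 g hz.1.2 ρ hz.2]
    simp
  · intro w _
    funext i
    obtain ⟨j, rfl⟩ := (Tuple.sort (fun i => decide (w i ∈ C))).surjective i
    simp only [inv_apply_apply]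
    induction j using Fin.addCases <;> simp
  · rintro ⟨⟨f, g⟩, ρ⟩ hz
    simp only [Finset.mem_product] at hz
    have hf := apply_mem_of_mem_words hz.1.1
    have hg := apply_mem_of_mem_words hz.1.2
    rw [shuffle_mul_sort hz.2 f g fun i j => h _ (hf i) _ (hg j),
      concat_wordTensor hd a f g hf hg, permTensor_wordTensor]

/-- The sum over the words with `c x` letters `x` for every `x ∈ B`, as an element of `F(A)`. -/
def wordSum (K : Type*) {A Λ : Type*} [CommSemiring K] [Semiring A] [Bialgebra K A]
    [Coalgebra.IsCocomm K A] [LinearOrder Λ] [Fintype Λ] (c : Λ → ℕ) (a : Λ → A)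
    (B : Finset Λ) : FreeQSym K A :=
  DirectSum.of (fun n => Comp K A n) (∑ x ∈ B, c x) (wordComp K (∑ x ∈ B, c x) B c a)

theorem wordSum_eq {n : ℕ} {c : Λ → ℕ} {B : Finset Λ} (h : ∑ x ∈ B, c x = n) (a : Λ → A) :
    wordSum K c a B = DirectSum.of (fun n => Comp K A n) n (wordComp K n B c a) := by
  subst h
  rfl

theorem wordSum_mul (c : Λ → ℕ) (a : Λ → A) (B C : Finset Λ) (h : ∀ x ∈ B, ∀ y ∈ C, x < y) :
    wordSum K c a B * wordSum K c a C = wordSum K c a (B ∪ C) := by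
  have hd : Disjoint B C := Finset.disjoint_left.2 fun x hB hC => (h x hB x hC).false
  rw [wordSum_eq (Finset.sum_union hd) a, wordSum, wordSum, of_mul_of,
    extProd_wordComp h c a rfl]

theorem wordSum_empty (c : Λ → ℕ) (a : Λ → A) : wordSum K c a ∅ = 1 := by
  rw [wordSum_eq Finset.sum_empty, one_eq, wordComp]
  have : words 0 (∅ : Finset Λ) c = {Fin.elim0} := by
    ext f
    simp [mem_words, fiber, Subsingleton.elim f Fin.elim0]
  rw [this, Finset.sum_singleton]
  congr 2
  · exact congrArg sharp (Subsingleton.elim _ _)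
  refine (Finset.noncommProd_empty _ _).trans ?_
  rw [PiTensorProduct.one_def]
  congr 1
  exact Subsingleton.elim _ _

theorem wordSum_singleton (c : Λ → ℕ) (a : Λ → A) (x : Λ) :
    wordSum K c a {x} = y K (c x) (a x) := by
  rw [wordSum_eq (Finset.sum_singleton _ _), y, wordComp]
  -- Only the constant word occurs; its stable sort is the identity and its single fibre is
  -- everything.
  have : words (c x) {x} c = {fun _ => x} := by
    ext f
    rw [Finset.mem_singleton]
    constructor
    · intro hf
      funext i
      exact Finset.mem_singleton.1 (apply_mem_of_mem_words hf i)
    · rintro rfl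
      rw [mem_words]
      intro z
      by_cases hz : z = x
      · subst hz
        simp [fiber]
      · simp [fiber, hz, Ne.symm hz]
  rw [this, Finset.sum_singleton]
  congr 2
  · exact congrArg sharp (Tuple.sort_eq_refl_iff_monotone.2 monotone_const)
  · refine (Finset.noncommProd_singleton _ _).trans ?_
    rw [← spread_univ]
    refine congrArg (fun S => spread K S (a x)) ?_
    simp [fiber]

theorem prod_ofFn_wordSum {k : ℕ} (c : Λ → ℕ) (a : Λ → A) (B : Fin k → Finset Λ)
    (hB : ∀ i j, i < j → ∀ x ∈ B i, ∀ z ∈ B j, x < z) :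
    (List.ofFn fun i => wordSum K c a (B i)).prod = wordSum K c a (Finset.univ.biUnion B) :=
  prod_ofFn_eq_biUnion (· < ·) (wordSum K c a) (wordSum_empty c a) (wordSum_mul c a) B hB

theorem prod_ofFn_y {k : ℕ} (c : Λ → ℕ) (a : Λ → A) (e : Fin k → Λ) (he : StrictMono e) :
    (List.ofFn fun i => y K (c (e i)) (a (e i))).prod =
      wordSum K c a (Finset.univ.biUnion fun i => {e i}) := by
  rw [← prod_ofFn_wordSum]
  · simp only [wordSum_singleton]
  · intro i j hij x hx z hz
    rw [Finset.mem_singleton.1 hx, Finset.mem_singleton.1 hz]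
    exact he hij

end WordComp

/-! ### The internal product of sums over words -/

section Twisted

variable {K A : Type*} [CommSemiring K] [Semiring A] [Algebra K A]

theorem twistedProd_sharp {n : ℕ} (σ τ : Equiv.Perm (Fin n)) (t u : ⨂[K]^n A) :
    twistedProd (sharp σ t) (sharp τ u) = sharp (σ * τ) (t * permTensor σ u) := by
  classical
  rw [twistedProd, Finset.sum_eq_single σ, Finset.sum_eq_single τ]
  · simp [coeff_sharp]
  · intro τ _ h
    simp [coeff_sharp, h.symm]
  · simp
  · intro τ _ h
    simp [coeff_sharp, h.symm]
  · simp

/-- The twisted product as a biadditive map. -/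
def twistedProdHom (n : ℕ) : Comp K A n →+ Comp K A n →+ Comp K A n where
  toFun α :=
    { toFun := twistedProd α
      map_zero' := by simp [twistedProd]
      map_add' := fun β γ => by simp [twistedProd, mul_add, Finset.sum_add_distrib] }
  map_zero' := AddMonoidHom.ext fun γ => show twistedProd 0 γ = 0 by simp [twistedProd]
  map_add' α β := AddMonoidHom.ext fun γ =>
      show twistedProd (α + β) γ = twistedProd α γ + twistedProd β γ by
    simp [twistedProd, add_mul, Finset.sum_add_distrib]

theorem twistedProd_sum {ι κ : Type*} {n : ℕ} (s : Finset ι) (t : Finset κ) (α : ι → Comp K A n)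
    (β : κ → Comp K A n) :
    twistedProd (∑ i ∈ s, α i) (∑ j ∈ t, β j) = ∑ i ∈ s, ∑ j ∈ t, twistedProd (α i) (β j) := by
  have h := DFunLike.congr_fun (map_sum (twistedProdHom n) α s) (∑ j ∈ t, β j)
  rw [AddMonoidHom.finsetSum_apply] at h
  exact h.trans (Finset.sum_congr rfl fun i _ => map_sum (twistedProdHom n (α i)) β t)

theorem internalProd_of_of {n : ℕ} (α β : Comp K A n) :
    internalProd (DirectSum.of (fun n => Comp K A n) n α) (DirectSum.of (fun n => Comp K A n) n β) =
      DirectSum.of (fun n => Comp K A n) n (twistedProd α β) := by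
  refine DFinsupp.ext fun m => ?_
  rw [internalProd_apply]
  by_cases h : n = m
  · subst h
    simp [DirectSum.of_eq_same]
  · rw [DirectSum.of_eq_of_ne _ _ _ (Ne.symm h), DirectSum.of_eq_of_ne _ _ _ (Ne.symm h)]
    simp [twistedProd, DirectSum.of_eq_of_ne _ _ _ (Ne.symm h)]

end Twisted

section Main

variable {K A : Type*} [CommSemiring K] [Semiring A] [Bialgebra K A] [Coalgebra.IsCocomm K A]

/-- For fixed `f`, transporting the second word along `Tuple.sort f` permutes the words of content
`d`, absorbs the place permutation, and makes the product of the two sorts a lexicographic one. -/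
theorem twistedProd_wordComp {Λ Λ' : Type*} [LinearOrder Λ] [Fintype Λ] [LinearOrder Λ']
    [Fintype Λ'] {n : ℕ} (B : Finset Λ) (B' : Finset Λ') (c : Λ → ℕ) (d : Λ' → ℕ) (a : Λ → A)
    (b : Λ' → A) :
    twistedProd (wordComp K n B c a) (wordComp K n B' d b) =
      ∑ f ∈ words n B c, ∑ g ∈ words n B' d, sharp (Tuple.sort fun i => toLex (g i, f i))
        (wordTensor K B a f * wordTensor K B' b g) := by
  rw [wordComp, wordComp, twistedProd_sum]
  refine Finset.sum_congr rfl fun f _ => ?_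
  refine Finset.sum_nbij' (fun g i => g ((Tuple.sort f)⁻¹ i)) (fun g i => g (Tuple.sort f i))
    (fun g hg => (comp_mem_words _).2 hg) (fun g hg => (comp_mem_words _).2 hg)
    (fun g _ => funext fun i => congrArg g (inv_apply_apply _ i))
    (fun g _ => funext fun i => congrArg g ((Tuple.sort f).apply_symm_apply i)) fun g _ => ?_
  rw [twistedProd_sharp, permTensor_wordTensor, ← sort_mul_sort]
  simp only [inv_apply_apply]

/-- A pair of words is one word of pairs, and its letter multiplicities form a matrix. Summing these
over one coordinate counts the occurrences of the other, so the margins are the contents `c` and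
`d`. -/
theorem sum_marginMatrices_words {M : Type*} [AddCommMonoid M] {k l n : ℕ} (c : Fin k → ℕ)
    (d : Fin l → ℕ) (F : (Fin n → Fin l ×ₗ Fin k) → M) :
    ∑ m ∈ marginMatrices c d, ∑ h ∈ words n (Finset.univ : Finset (Fin l ×ₗ Fin k))
        (fun z => m (ofLex z).2 (ofLex z).1), F h =
      ∑ f ∈ words n Finset.univ c, ∑ g ∈ words n Finset.univ d, F fun i => toLex (g i, f i) := by
  have hrow : ∀ (h : Fin n → Fin l ×ₗ Fin k) (i : Fin k),
      ∑ j, (fiber h (toLex (j, i))).card = (fiber (fun p => (ofLex (h p)).2) i).card := by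
    intro h i
    rw [← Finset.card_biUnion]
    · congr 1
      ext p
      simp only [Finset.mem_biUnion, Finset.mem_univ, true_and, mem_fiber]
      exact ⟨fun ⟨j, hj⟩ => by rw [hj, ofLex_toLex], fun e => ⟨(ofLex (h p)).1, by rw [← e]; rfl⟩⟩
    · exact fun j _ j' _ hj => disjoint_fiber _ fun e => hj (congrArg (fun z => (ofLex z).1) e)
  have hcol : ∀ (h : Fin n → Fin l ×ₗ Fin k) (j : Fin l),
      ∑ i, (fiber h (toLex (j, i))).card = (fiber (fun p => (ofLex (h p)).1) j).card := by
    intro h j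
    rw [← Finset.card_biUnion]
    · congr 1
      ext p
      simp only [Finset.mem_biUnion, Finset.mem_univ, true_and, mem_fiber]
      exact ⟨fun ⟨j, hj⟩ => by rw [hj, ofLex_toLex], fun e => ⟨(ofLex (h p)).2, by rw [← e]; rfl⟩⟩
    · exact fun j _ j' _ hj => disjoint_fiber _ fun e => hj (congrArg (fun z => (ofLex z).2) e)
  rw [Finset.sum_sigma', ← Finset.sum_product']
  refine Finset.sum_bij' (fun x _ => (fun p => (ofLex (x.2 p)).2, fun p => (ofLex (x.2 p)).1))
    (fun z _ => ⟨Matrix.of fun i j => (fiber (fun p => toLex (z.2 p, z.1 p)) (toLex (j, i))).card,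
      fun p => toLex (z.2 p, z.1 p)⟩) ?_ ?_ ?_ ?_ ?_
  · rintro ⟨m, h⟩ hx
    simp only [Finset.mem_sigma, mem_marginMatrices, mem_words, Finset.mem_univ, if_true] at hx
    simp only [Finset.mem_product, mem_words, Finset.mem_univ, if_true, ← hrow, ← hcol, hx.2]
    exact hx.1
  · rintro ⟨f, g⟩ hz
    simp only [Finset.mem_product, mem_words, Finset.mem_univ, if_true] at hz
    simp only [Finset.mem_sigma, mem_marginMatrices, mem_words, Finset.mem_univ, if_true,
      Matrix.of_apply, hrow, hcol]
    exact ⟨hz, fun x => rfl⟩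
  · rintro ⟨m, h⟩ hx
    simp only [Finset.mem_sigma, mem_words, Finset.mem_univ, if_true] at hx
    simp only [Prod.mk.eta, toLex_ofLex, hx.2, ofLex_toLex]
    rfl
  · rintro ⟨f, g⟩ _
    rfl
  · rintro ⟨m, h⟩ _
    rfl

theorem biUnion_singleton_univ {k : ℕ} :
    (Finset.univ.biUnion fun i : Fin k => {id i}) = (Finset.univ : Finset (Fin k)) := by
  ext
  simp

theorem prod_ofFn_y_univ {k n : ℕ} (c : Fin k → ℕ) (hc : ∑ i, c i = n) (a : Fin k → A) :
    (List.ofFn fun i => y K (c i) (a i)).prod =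
      DirectSum.of (fun n => Comp K A n) n (wordComp K n Finset.univ c a) := by
  refine (prod_ofFn_y c a id strictMono_id).trans ?_
  rw [biUnion_singleton_univ, wordSum_eq hc]

/-- The lexicographic order on $(j,i)$ is the column by column order, so each column is an interval
of letters and successive columns are separated. -/
theorem prod_ofFn_prod_ofFn_y {k l n : ℕ} (c : Fin l ×ₗ Fin k → ℕ) (hc : ∑ z, c z = n)
    (a : Fin l ×ₗ Fin k → A) :
    (List.ofFn fun j => (List.ofFn fun i => y K (c (toLex (j, i))) (a (toLex (j, i)))).prod).prod =
      DirectSum.of (fun n => Comp K A n) n (wordComp K n Finset.univ c a) := by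
  have e : ∀ j, (List.ofFn fun i => y K (c (toLex (j, i))) (a (toLex (j, i)))).prod =
      wordSum K c a (Finset.univ.biUnion fun i => {toLex (j, i)}) := fun j =>
    prod_ofFn_y c a (fun i => toLex (j, i)) fun i i' h => Prod.Lex.toLex_lt_toLex.2 (Or.inr ⟨rfl, h⟩)
  simp only [e]
  rw [prod_ofFn_wordSum, ← wordSum_eq hc]
  · congr 1
    ext z
    simp only [Finset.mem_biUnion, Finset.mem_univ, true_and, Finset.mem_singleton, iff_true]
    exact ⟨(ofLex z).1, (ofLex z).2, rfl⟩
  · intro j j' hj x hx z hz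
    simp only [Finset.mem_biUnion, Finset.mem_univ, true_and, Finset.mem_singleton] at hx hz
    obtain ⟨i, rfl⟩ := hx
    obtain ⟨i', rfl⟩ := hz
    exact Prod.Lex.toLex_lt_toLex.2 (Or.inl hj)

end Main

end FreeQSym

end
-- The product formula
theorem mainTheorem7 {K A : Type*} [CommRing K] [Ring A] [Bialgebra K A] [Coalgebra.IsCocomm K A]
    {n : ℕ} (hn : 0 < n) (c d : Composition n)
    (a : Fin c.length → A) (b : Fin d.length → A)
    (p : ∀ i, FreeQSym.Sweedler K d.length (a i))
    (q : ∀ j, FreeQSym.Sweedler K c.length (b j)) :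
    FreeQSym.internalProd
        (List.ofFn fun i => FreeQSym.y K (c.blocksFun i) (a i)).prod
        (List.ofFn fun j => FreeQSym.y K (d.blocksFun j) (b j)).prod =
      ∑ s : (∀ i, Fin (p i).size), ∑ t : (∀ j, Fin (q j).size),
        ∑ M ∈ FreeQSym.marginMatrices c.blocksFun d.blocksFun,
          (List.ofFn fun j => (List.ofFn fun i =>
            FreeQSym.y K (M i j) ((p i).term (s i) j * (q j).term (t j) i)).prod).prod := by
  open FreeQSym in
  rw [prod_ofFn_y_univ _ c.sum_blocksFun, prod_ofFn_y_univ _ d.sum_blocksFun, internalProd_of_of,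
    twistedProd_wordComp]
  simp only [wordTensor_mul a b p q, map_sum]
  rw [← Finset.sum_product', Finset.sum_comm]
  refine Finset.sum_congr rfl fun s _ => ?_
  rw [Finset.sum_comm]
  refine Finset.sum_congr rfl fun t _ => ?_
  rw [Finset.sum_product]
  -- For fixed Sweedler terms `s` and `t` the summand depends on the pair of words only through the
  -- word of pairs, so it can be regrouped by multiplicity matrices.
  refine (sum_marginMatrices_words c.blocksFun d.blocksFun fun h =>
    DirectSum.of (fun n => Comp K A n) n (sharp (Tuple.sort h) (wordTensor K Finset.univ
      (fun z : Fin d.length ×ₗ Fin c.length => (p (ofLex z).2).term (s (ofLex z).2) (ofLex z).1 *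
        (q (ofLex z).1).term (t (ofLex z).1) (ofLex z).2) h))).symm.trans ?_
  refine Finset.sum_congr rfl fun M hM => ?_
  have hM' : ∑ z : Fin d.length ×ₗ Fin c.length, M (ofLex z).2 (ofLex z).1 = n := by
    refine (Fintype.sum_prod_type_right fun z : Fin d.length × Fin c.length => M z.2 z.1).trans ?_
    simp only [((mem_marginMatrices _ _ M).1 hM).1]
    exact c.sum_blocksFun
  refine Eq.trans ?_ (prod_ofFn_prod_ofFn_y (fun z => M (ofLex z).2 (ofLex z).1) hM' fun z =>
    (p (ofLex z).2).term (s (ofLex z).2) (ofLex z).1 *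
        (q (ofLex z).1).term (t (ofLex z).1) (ofLex z).2).symm
  rw [wordComp, map_sum]
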